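/- Digraphs are finite, unweighted and directed (self-loops are permitted), with vertex set $\{0,\dots,n-1\}$; $\mathrm{diam}(G)=\max_{u,v}d_G(u,v)$, where $d_G(u,v)$ is the least number of edges of a directed walk from $u$ to $v$; a subgraph $H\subseteq G$ has the same vertex set as $G$ and a subset of its edges. **Theorem.** There are an absolute constant $C$ and an algorithm (a total computable function on edge lists) that, given $n$ and an edge list of a digraph $G$ on $n$ vertices, outputs an edge list of a digraph $A(G)$ on the same vertices, depending only on $G$, such that the following hold. 1. For every strongly connected digraph $G$ on $n$ vertices, $H=A(G)$ is a strongly connected subgraph of $G$ with at most $C\,n\log^2 n$ edges and $$\mathrm{diam}(H)\le \mathrm{diam}(G)+\frac{n}{n^{1/6}}.$$ 2. If $\mathrm{diam}(G)=\omega(n^{5/6})$, then $\mathrm{diam}(H)\le(1+o(1))\,\mathrm{diam}(G)$. That is, for every sequence $(G_k)_{k\in\mathbb N}$ of strongly connected digraphs, $G_k$ on $n_k$ vertices, with $n_k^{5/6}=o(\mathrm{diam}(G_k))$ as $k\to\infty$, there are reals $\delta_k\to 0$ such that $\mathrm{diam}(A(G_k))\le(1+\delta_k)\,\mathrm{diam}(G_k)$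 for all $k$. -/

import Mathlib

open Filter Topology Asymptotics

namespace Digraph

/-- `G.WalkOfLength k u v`: there is a directed walk with exactly `k` edges from `u` to `v`. -/
inductive WalkOfLength {V : Type*} (G : Digraph V) : ℕ → V → V → Prop
  | nil (u : V) : WalkOfLength G 0 u u
  | cons {k : ℕ} {u v w : V} (h : G.Adj u v) (p : WalkOfLength G k v w) :
      WalkOfLength G (k + 1) u w

/-- The distance from `u` to `v`: the least length of a directed walk from `u` to `v`, and `⊤` if
there is none. -/
noncomputable def edist {V : Type*} (G : Digraph V) (u v : V) : ℕ∞ :=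
  ⨅ (k : ℕ) (_ : G.WalkOfLength k u v), (k : ℕ∞)

/-- The diameter as an extended natural number. -/
noncomputable def ediam {V : Type*} (G : Digraph V) : ℕ∞ :=
  ⨆ (u : V) (v : V), G.edist u v

/-- The diameter of a strongly connected finite digraph, as a natural number. (The value is
meaningful only when `G.ediam` is finite.) -/
noncomputable def diam {V : Type*} (G : Digraph V) : ℕ :=
  G.ediam.toNat

/-- Every vertex can be reached from every vertex along a directed walk. -/
def StronglyConnected {V : Type*} (G : Digraph V) : Prop :=
  ∀ u v : V, ∃ k : ℕ, G.WalkOfLength k u v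

/-- The number of (directed) edges. -/
noncomputable def numEdges {V : Type*} (G : Digraph V) : ℕ :=
  {e : V × V | G.Adj e.1 e.2}.ncard

/-- The digraph with vertex set `{0, …, n - 1}` whose edges are the pairs listed in `L` (pairs with
an entry that is not a vertex are ignored). -/
def ofEdgeList (n : ℕ) (L : List (ℕ × ℕ)) : Digraph (Fin n) where
  Adj u v := ((u : ℕ), (v : ℕ)) ∈ L

/-- Every digraph on `{0, …, n - 1}` is given by an edge list. -/
theorem exists_ofEdgeList_eq {n : ℕ} (G : Digraph (Fin n)) :
    ∃ L : List (ℕ × ℕ), ofEdgeList n L = G := by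
  classical
  refine ⟨((Finset.univ.filter fun e : Fin n × Fin n => G.Adj e.1 e.2).toList).map
    fun e => ((e.1 : ℕ), (e.2 : ℕ)), ?_⟩
  ext u v
  simp only [ofEdgeList, List.mem_map, Finset.mem_toList, Finset.mem_filter, Finset.mem_univ,
    true_and, Prod.mk.injEq]
  constructor
  · rintro ⟨⟨a, b⟩, h, ha, hb⟩
    rw [← Fin.ext ha, ← Fin.ext hb]
    exact h
  · intro h
    exact ⟨(u, v), h, rfl, rfl⟩

/-- An operation `A` that sends each digraph on `{0, …, n - 1}`, for each `n`, to a digraph on the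
same vertices is computable if one (total, Turing computable) algorithm, given `n` and any edge list
of a digraph `G`, outputs an edge list of `A n G`. -/
def IsComputable (A : (n : ℕ) → Digraph (Fin n) → Digraph (Fin n)) : Prop :=
  ∃ a : ℕ × List (ℕ × ℕ) → List (ℕ × ℕ), Computable a ∧
    ∀ (n : ℕ) (L : List (ℕ × ℕ)), ofEdgeList n (a (n, L)) = A n (ofEdgeList n L)

end Digraph

/-! Let `l` be the integer part of log₂ n. In a strongly connected digraph each ball of radius r <
n, in either direction, has more than r vertices. With r about n^(5/6)/2, the union bound gives a
set S of O(n^(1/6) l) hubs meeting all 2n of these balls (`exists_hub_set`). Keep a forest of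
shortest walks into S, one out of S, and a subgraph joining each pair of S × S within diam(G).
Routing u → s → t → v costs at most r + diam(G) + r.

The forests have at most 2n edges, so the point is to make the third subgraph sparse
(`exists_preserver`). In an edge-minimal one, every edge is critical: all shortest walks of some
pair in P = S × S use it. Assign to each vertex with three distinct in-neighbours the triple of
pairs for which these edges are critical. If one triple of pairs served two vertices v ≠ w, two of
its pairs would visit v and w in the same order; exchanging their equally long segments would make
their critical edges into the later vertex coincide. So the assignment is injective, and ∑
d(d-1)(d-2) ≤ |P|³ over in-degrees d (`sum_descFactorial_le`). As |P|³ = O(n l⁶), this leaves O(n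
l²) edges.

For computability, existence suffices: the required properties are witnessed by finite data and
checked by a primitive recursive relation on edge lists, so exhaustive search finds a spanner. All
bounds are put in integer form (`IsSpanner`), and the search returns the first accepted code, so its
output depends only on the digraph and not on the list presenting it. -/

namespace Digraph

variable {V : Type*} {G H : Digraph V}

/-! ### Walks, bounded reachability and the diameter -/

namespace WalkOfLength

theorem append {i j : ℕ} {u v w : V} (p : G.WalkOfLength i u v) (q : G.WalkOfLength j v w) :
    G.WalkOfLength (i + j) u w := by
  induction p with
  | nil u => simpa using q
  | cons h _ ih => rw [Nat.add_right_comm]; exact cons h (ih q)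

theorem single {u v : V} (h : G.Adj u v) : G.WalkOfLength 1 u v := cons h (nil v)

theorem concat {i : ℕ} {u v w : V} (p : G.WalkOfLength i u v) (h : G.Adj v w) :
    G.WalkOfLength (i + 1) u w := p.append (single h)

theorem mono (hle : G ≤ H) {i : ℕ} {u v : V} (p : G.WalkOfLength i u v) :
    H.WalkOfLength i u v := by
  induction p with
  | nil u => exact nil u
  | cons h _ ih => exact cons (hle h) ih

theorem eq_of_zero {u v : V} (p : G.WalkOfLength 0 u v) : u = v := by
  cases p; rfl

theorem exists_concat {i : ℕ} {u w : V} (p : G.WalkOfLength (i + 1) u w) :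
    ∃ v, G.WalkOfLength i u v ∧ G.Adj v w := by
  induction i generalizing u with
  | zero =>
    cases p with
    | cons h q => exact ⟨u, nil u, q.eq_of_zero ▸ h⟩
  | succ i ih =>
    cases p with
    | cons h q =>
      obtain ⟨v, hv, hvw⟩ := ih q
      exact ⟨v, cons h hv, hvw⟩

end WalkOfLength

/-- The digraph with all edges reversed. -/
def reverse (G : Digraph V) : Digraph V where
  Adj u v := G.Adj v u

theorem WalkOfLength.reverse {i : ℕ} {u v : V} (p : G.WalkOfLength i u v) :
    G.reverse.WalkOfLength i v u := by
  induction p with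
  | nil u => exact nil u
  | cons h _ ih => exact ih.concat h

/-- There is a walk with at most `k` edges from `u` to `v`. -/
def Within (G : Digraph V) (k : ℕ) (u v : V) : Prop :=
  ∃ j ≤ k, G.WalkOfLength j u v

namespace Within

theorem refl (G : Digraph V) (k : ℕ) (u : V) : G.Within k u u := ⟨0, k.zero_le, .nil u⟩

theorem mono {k l : ℕ} (hle : G ≤ H) (hkl : k ≤ l) {u v : V} : G.Within k u v → H.Within l u v
  | ⟨j, hj, p⟩ => ⟨j, hj.trans hkl, p.mono hle⟩

theorem trans {k l : ℕ} {u v w : V} : G.Within k u v → G.Within l v w → G.Within (k + l) u w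
  | ⟨i, hi, p⟩, ⟨j, hj, q⟩ => ⟨i + j, add_le_add hi hj, p.append q⟩

theorem reverse {k : ℕ} {u v : V} : G.Within k u v → G.reverse.Within k v u
  | ⟨j, hj, p⟩ => ⟨j, hj, p.reverse⟩

end Within

theorem within_zero {u v : V} : G.Within 0 u v ↔ u = v := by
  constructor
  · rintro ⟨j, hj, p⟩
    obtain rfl : j = 0 := by omega
    exact p.eq_of_zero
  · rintro rfl
    exact .refl G 0 u

theorem within_succ {k : ℕ} {u w : V} :
    G.Within (k + 1) u w ↔ G.Within k u w ∨ ∃ v, G.Within k u v ∧ G.Adj v w := by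
  constructor
  · rintro ⟨j, hj, p⟩
    cases j with
    | zero => exact Or.inl ⟨0, k.zero_le, p⟩
    | succ j =>
      obtain ⟨v, hv, hvw⟩ := p.exists_concat
      exact Or.inr ⟨v, ⟨j, by omega, hv⟩, hvw⟩
  · rintro (h | ⟨v, ⟨j, hj, p⟩, h⟩)
    · exact h.mono le_rfl k.le_succ
    · exact ⟨j + 1, by omega, p.concat h⟩

theorem edist_le_iff {k : ℕ} {u v : V} : G.edist u v ≤ k ↔ G.Within k u v := by
  constructor
  · intro h
    have h' : G.edist u v < ((k + 1 : ℕ) : ℕ∞) :=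
      lt_of_le_of_lt h (by exact_mod_cast k.lt_succ_self)
    simp only [edist, iInf_lt_iff] at h'
    obtain ⟨j, p, hj⟩ := h'
    exact ⟨j, Nat.lt_succ_iff.1 (by exact_mod_cast hj), p⟩
  · rintro ⟨j, hj, p⟩
    exact (iInf₂_le j p).trans (by exact_mod_cast hj)

theorem ediam_le_iff {k : ℕ} : G.ediam ≤ k ↔ ∀ u v, G.Within k u v := by
  simp only [ediam, iSup_le_iff, edist_le_iff]

theorem diam_le_of_within {k : ℕ} (h : ∀ u v, G.Within k u v) : G.diam ≤ k :=
  ENat.toNat_le_of_le_natCast (ediam_le_iff.2 h)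

theorem stronglyConnected_of_within {k : ℕ} (h : ∀ u v, G.Within k u v) : G.StronglyConnected :=
  fun u v => let ⟨j, _, p⟩ := h u v; ⟨j, p⟩

theorem StronglyConnected.reverse (hG : G.StronglyConnected) : G.reverse.StronglyConnected :=
  fun u v => let ⟨k, p⟩ := hG v u; ⟨k, p.reverse⟩

/-! ### Ball growth and hitting sets -/

/-- Balls in a strongly connected digraph gain a vertex with each unit of radius. -/
theorem StronglyConnected.min_le_card_ball {n : ℕ} {G : Digraph (Fin n)}
    (hG : G.StronglyConnected) (u : Fin n) (r : ℕ) :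
    min n (r + 1) ≤ {v | G.Within r u v}.ncard := by
  induction r with
  | zero =>
    have : 1 ≤ {v | G.Within 0 u v}.ncard :=
      (Set.ncard_pos (Set.toFinite _)).2 ⟨u, .refl G 0 u⟩
    omega
  | succ r ih =>
    by_cases hall : ∀ v, G.Within r u v
    · have : {v | G.Within (r + 1) u v} = Set.univ :=
        Set.eq_univ_of_forall fun v => (hall v).mono le_rfl r.le_succ
      rw [this, Set.ncard_univ, Nat.card_eq_fintype_card, Fintype.card_fin]
      exact min_le_left _ _
    · have key : ∃ v, G.Within (r + 1) u v ∧ ¬ G.Within r u v := by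
        -- A ball that stops growing is closed under out-edges, so by strong connectivity it is
        -- everything.
        by_contra! hcon
        refine hall fun v => ?_
        obtain ⟨k, p⟩ := hG u v
        have : ∀ (k : ℕ) (v : Fin n), G.WalkOfLength k u v → G.Within r u v := by
          intro k
          induction k with
          | zero => intro v p; exact p.eq_of_zero ▸ .refl G r u
          | succ k ihk =>
            intro v p
            obtain ⟨w, hw, hwv⟩ := p.exists_concat
            exact hcon v (within_succ.2 (Or.inr ⟨w, ihk w hw, hwv⟩))
        exact this k v p
      obtain ⟨v, hv, hv'⟩ := key
      have : {v | G.Within r u v}.ncard < {v | G.Within (r + 1) u v}.ncard :=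
        Set.ncard_lt_ncard ⟨fun w hw => Within.mono le_rfl r.le_succ hw, fun h => hv' (h hv)⟩
          (Set.toFinite _)
      omega

theorem StronglyConnected.within_pred {n : ℕ} {G : Digraph (Fin n)} (hG : G.StronglyConnected)
    (u v : Fin n) : G.Within (n - 1) u v := by
  have h := hG.min_le_card_ball u (n - 1)
  have hn : 0 < n := u.pos
  have h2 : {v | G.Within (n - 1) u v} = Set.univ := by
    refine Set.eq_of_subset_of_ncard_le (Set.subset_univ _) ?_ (Set.toFinite _)
    rw [Set.ncard_univ, Nat.card_eq_fintype_card, Fintype.card_fin]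
    omega
  exact h2.ge (Set.mem_univ v)

/-- Strong connectivity bounds `ediam` by n - 1, so `diam` is not the default value of `toNat` at
`⊤`. -/
theorem StronglyConnected.within_diam {n : ℕ} {G : Digraph (Fin n)} (hG : G.StronglyConnected)
    (u v : Fin n) : G.Within G.diam u v := by
  have h : G.ediam ≤ ((n - 1 : ℕ) : ℕ∞) := ediam_le_iff.2 hG.within_pred
  refine ediam_le_iff.1 ?_ u v
  rw [diam, ENat.natCast_toNat (ne_top_of_le_ne_top (ENat.natCast_ne_top _) h)]

/-- A hitting set of size at most `k` for a family of large sets, from the union bound over all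
`k`-tuples. -/
theorem _root_.Finset.exists_hitting_set {n k R : ℕ} {ι : Type*} [Fintype ι]
    (B : ι → Finset (Fin n)) (hB : ∀ i, R ≤ (B i).card)
    (h : Fintype.card ι * (n - R) ^ k < n ^ k) :
    ∃ S : Finset (Fin n), S.card ≤ k ∧ ∀ i, ∃ s ∈ S, s ∈ B i := by
  classical
  let U : Finset (Fin k → Fin n) :=
    Finset.univ.biUnion fun i : ι => Fintype.piFinset fun _ : Fin k => (B i)ᶜ
  have hU : U.card < Fintype.card (Fin k → Fin n) := by
    calc U.card ≤ ∑ i : ι, (Fintype.piFinset fun _ : Fin k => (B i)ᶜ).card :=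
          Finset.card_biUnion_le
      _ ≤ ∑ _i : ι, (n - R) ^ k := by
          refine Finset.sum_le_sum fun i _ => ?_
          simp only [Fintype.card_piFinset, Finset.prod_const, Finset.card_univ, Fintype.card_fin,
            Finset.card_compl]
          exact Nat.pow_le_pow_left (Nat.sub_le_sub_left (hB i) n) k
      _ = Fintype.card ι * (n - R) ^ k := by simp
      _ < n ^ k := h
      _ = _ := by simp
  obtain ⟨f, hf⟩ : ∃ f, f ∉ U := by
    by_contra! hcon
    exact hU.ne (by rw [Finset.eq_univ_of_forall hcon, Finset.card_univ])
  refine ⟨Finset.univ.image f, Finset.card_image_le.trans (by simp), fun i => ?_⟩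
  by_contra! hcon
  refine hf (Finset.mem_biUnion.2 ⟨i, Finset.mem_univ i, Fintype.mem_piFinset.2 fun x => ?_⟩)
  exact Finset.mem_compl.2 (hcon _ (Finset.mem_image_of_mem f (Finset.mem_univ x)))

/-! ### Edge counts and shortest-walk forests -/

theorem numEdges_sup_le [Finite V] (G H : Digraph V) :
    (G ⊔ H).numEdges ≤ G.numEdges + H.numEdges := by
  refine le_trans (Set.ncard_le_ncard ?_ (Set.toFinite _)) (Set.ncard_union_le _ _)
  intro e he
  exact he

theorem numEdges_reverse [Finite V] (G : Digraph V) : G.reverse.numEdges = G.numEdges := by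
  have : {e : V × V | G.reverse.Adj e.1 e.2} = Prod.swap '' {e : V × V | G.Adj e.1 e.2} := by
    ext ⟨a, b⟩
    simp [reverse]
  rw [numEdges, this, Set.ncard_image_of_injective _ Prod.swap_injective, numEdges]

/-- If every vertex reaches `S` within `r` steps, a subgraph with one edge out of each vertex
witnesses it. -/
theorem exists_forest [Fintype V] (G : Digraph V) (S : Set V) (r : ℕ)
    (h : ∀ u, ∃ s ∈ S, G.Within r u s) :
    ∃ F ≤ G, F.numEdges ≤ Fintype.card V ∧ ∀ u, ∃ s ∈ S, F.Within r u s := by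
  classical
  have hex : ∀ u, ∃ j, ∃ s ∈ S, G.WalkOfLength j u s := fun u =>
    let ⟨s, hs, j, _, p⟩ := h u; ⟨j, s, hs, p⟩
  let d : V → ℕ := fun u => Nat.find (hex u)
  -- The second vertex of a shortest walk to S is strictly closer to S; vertices with `d u = 0` are
  -- roots and get no out-edge.
  have hstep : ∀ u, ∃ v, d u ≠ 0 → G.Adj u v ∧ d v + 1 ≤ d u := by
    intro u
    by_cases hu : d u = 0
    · exact ⟨u, fun h => absurd hu h⟩
    obtain ⟨s, hs, p⟩ := Nat.find_spec (hex u)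
    obtain ⟨m, hm⟩ := Nat.exists_eq_succ_of_ne_zero hu
    change G.WalkOfLength (d u) u s at p
    rw [hm] at p
    cases p with
    | cons huv q =>
      refine ⟨_, fun _ => ⟨huv, ?_⟩⟩
      rw [hm]
      exact Nat.succ_le_succ (Nat.find_min' (hex _) ⟨s, hs, q⟩)
  choose f hf using hstep
  let F : Digraph V := ⟨fun u v => d u ≠ 0 ∧ v = f u⟩
  refine ⟨F, ?_, ?_, ?_⟩
  · rintro u v ⟨h0, rfl⟩
    exact (hf u h0).1
  · have : {e : V × V | F.Adj e.1 e.2} ⊆ Set.range fun u => (u, f u) := by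
      rintro ⟨u, v⟩ ⟨-, hv⟩
      exact ⟨u, Prod.ext rfl hv.symm⟩
    calc F.numEdges ≤ (Set.range fun u => (u, f u)).ncard :=
          Set.ncard_le_ncard this (Set.toFinite _)
      _ ≤ Fintype.card V := by
          rw [← Set.image_univ, ← Nat.card_eq_fintype_card, ← Set.ncard_univ]
          exact Set.ncard_image_le
  · have key : ∀ k u, d u ≤ k → ∃ s ∈ S, F.Within k u s := by
      intro k
      induction k with
      | zero =>
        intro u hu
        obtain ⟨s, hs, p⟩ := Nat.find_spec (hex u)
        have hu0 : Nat.find (hex u) = 0 := Nat.le_zero.1 hu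
        rw [hu0] at p
        exact ⟨s, hs, within_zero.2 p.eq_of_zero⟩
      | succ k ih =>
        intro u hu
        by_cases h0 : d u = 0
        · obtain ⟨s, hs, hw⟩ := ih u (by omega)
          exact ⟨s, hs, hw.mono le_rfl k.le_succ⟩
        · obtain ⟨s, hs, j, hj, p⟩ := ih (f u) (by have := (hf u h0).2; omega)
          exact ⟨s, hs, j + 1, by omega, .cons ⟨h0, rfl⟩ p⟩
    intro u
    obtain ⟨s, hs, j, hj, p⟩ := h u
    exact key r u ((Nat.find_min' (hex u) ⟨s, hs, p⟩).trans hj)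

/-! ### Critical edges and sparse pairwise preservers -/

/-- Remove the edge from `b` to `w`. -/
def deleteEdge (G : Digraph V) (b w : V) : Digraph V where
  Adj x y := G.Adj x y ∧ ¬ (x = b ∧ y = w)

theorem deleteEdge_le (G : Digraph V) (b w : V) : G.deleteEdge b w ≤ G := fun _ _ h => h.1

theorem numEdges_deleteEdge_lt [Finite V] {b w : V} (h : G.Adj b w) :
    (G.deleteEdge b w).numEdges < G.numEdges :=
  Set.ncard_lt_ncard
    ⟨fun _ he => he.1, fun hsub => (hsub (show (b, w) ∈ {e : V × V | G.Adj e.1 e.2} from h)).2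
      ⟨rfl, rfl⟩⟩ (Set.toFinite _)

theorem WalkOfLength.deleteEdge_or {i : ℕ} {u v : V} (b w : V) (p : G.WalkOfLength i u v) :
    (G.deleteEdge b w).WalkOfLength i u v ∨
      ∃ x y, x + 1 + y = i ∧ G.WalkOfLength x u b ∧ G.Adj b w ∧ G.WalkOfLength y w v := by
  induction p with
  | nil u => exact Or.inl (nil u)
  | @cons k u v z h p ih =>
    by_cases he : u = b ∧ v = w
    · obtain ⟨rfl, rfl⟩ := he
      exact Or.inr ⟨0, k, by omega, nil u, h, p⟩
    · rcases ih with ih | ⟨x, y, hxy, p1, hbw, p2⟩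
      · exact Or.inl (cons ⟨h, he⟩ ih)
      · exact Or.inr ⟨x + 1, y, by omega, cons h p1, hbw, p2⟩

/-- The distance from `s` to `t` is `j`, and every walk of length `j` from `s` to `t` uses the edge
from `b` to `w`. -/
structure IsCritical (G : Digraph V) (j : ℕ) (b w s t : V) : Prop where
  walk : G.WalkOfLength j s t
  min : ∀ i, G.WalkOfLength i s t → j ≤ i
  not_walk : ¬ (G.deleteEdge b w).WalkOfLength j s t

/-- `v` precedes `w` on some walk of length `j` from `s` to `t`. -/
def Precedes (G : Digraph V) (j : ℕ) (s t v w : V) : Prop :=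
  ∃ α β γ, α + β + γ = j ∧ G.WalkOfLength α s v ∧ G.WalkOfLength β v w ∧ G.WalkOfLength γ w t

namespace IsCritical

/-- A shortest walk meets `w` only once, since a second visit could be cut out. Entering `w` from `c
≠ b` would therefore avoid the critical edge altogether. -/
theorem eq_of_adj {j i k : ℕ} {b w s t c : V} (hc : G.IsCritical j b w s t)
    (p : G.WalkOfLength i s c) (h : G.Adj c w) (q : G.WalkOfLength k w t) (hj : i + 1 + k = j) :
    c = b := by
  by_contra hne
  rcases p.deleteEdge_or b w with p' | ⟨x, y, hxy, p1, hbw, -⟩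
  · rcases q.deleteEdge_or b w with q' | ⟨x, y, hxy, -, -, q2⟩
    · exact hc.not_walk (hj ▸ (p'.concat ⟨h, fun hh => hne hh.1⟩).append q')
    · have := hc.min _ ((p.concat h).append q2)
      omega
  · have := hc.min _ ((p1.concat hbw).append q)
    omega

theorem length_eq {j j' : ℕ} {b w b' w' s t : V} (h : G.IsCritical j b w s t)
    (h' : G.IsCritical j' b' w' s t) : j = j' :=
  le_antisymm (h.min _ h'.walk) (h'.min _ h.walk)

theorem eq_of_head_eq {j j' : ℕ} {a b w s t : V} (h : G.IsCritical j a w s t)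
    (h' : G.IsCritical j' b w s t) : a = b := by
  obtain rfl := h.length_eq h'
  rcases h.walk.deleteEdge_or a w with p | ⟨x, y, hxy, p, haw, q⟩
  · exact absurd p h.not_walk
  · exact h'.eq_of_adj p haw q hxy

/-- One shortest walk contains both critical edges, and their order along it decides the
alternative. -/
theorem precedes_or {j j' : ℕ} {a v b w s t : V} (h : G.IsCritical j a v s t)
    (h' : G.IsCritical j' b w s t) : G.Precedes j s t v w ∨ G.Precedes j s t w v := by
  obtain rfl := h.length_eq h'
  rcases h.walk.deleteEdge_or a v with p | ⟨x, y, hxy, p, hav, q⟩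
  · exact absurd p h.not_walk
  rcases (p.concat hav).deleteEdge_or b w with p' | ⟨x1, y1, hxy1, p1, hbw, p2⟩
  · rcases q.deleteEdge_or b w with q' | ⟨x1, y1, hxy1, q1, hbw, q2⟩
    · exact absurd (hxy ▸ p'.append q') h'.not_walk
    · exact Or.inl ⟨x + 1, x1 + 1, y1, by omega, p.concat hav, q1.concat hbw, q2⟩
  · exact Or.inr ⟨x1 + 1, y1, y, by omega, p1.concat hbw, p2, q⟩

/-- Two pairs whose shortest walks visit `v` before `w` cannot have distinct critical edges
into `w`: their segments from `v` to `w` can be exchanged. -/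
theorem eq_of_precedes {j₁ j₂ : ℕ} {v w b₁ s₁ t₁ b₂ s₂ t₂ : V} (hvw : v ≠ w)
    (h₁ : G.IsCritical j₁ b₁ w s₁ t₁) (h₂ : G.IsCritical j₂ b₂ w s₂ t₂)
    (hp₁ : G.Precedes j₁ s₁ t₁ v w) (hp₂ : G.Precedes j₂ s₂ t₂ v w) : b₁ = b₂ := by
  obtain ⟨α₁, β₁, γ₁, e₁, p₁, q₁, r₁⟩ := hp₁
  obtain ⟨α₂, β₂, γ₂, e₂, p₂, q₂, r₂⟩ := hp₂
  -- Swapping the segments cannot shorten either walk, so they have equal length. The last edge `c →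
  -- w` of the second segment thus lies on shortest walks of both pairs, and `c` is both `b₁` and
  -- `b₂`.
  have l₁ := h₁.min _ ((p₁.append q₂).append r₁)
  have l₂ := h₂.min _ ((p₂.append q₁).append r₂)
  cases β₂ with
  | zero => exact absurd q₂.eq_of_zero hvw
  | succ β =>
    obtain ⟨c, q, hc⟩ := q₂.exists_concat
    rw [← h₁.eq_of_adj (p₁.append q) hc r₁ (by omega),
      ← h₂.eq_of_adj (p₂.append q) hc r₂ (by omega)]

end IsCritical

/-- Take `j` to be the distance: as `j ≤ D`, a walk of length `j` surviving the deletion would keep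
the pair within `D`. -/
theorem exists_isCritical [Finite V] {D : ℕ} {b w s t : V}
    (h : G.Within D s t) (h' : ¬ (G.deleteEdge b w).Within D s t) :
    ∃ j, G.IsCritical j b w s t := by
  classical
  obtain ⟨i, hi, p⟩ := h
  have hex : ∃ j, G.WalkOfLength j s t := ⟨i, p⟩
  exact ⟨Nat.find hex, Nat.find_spec hex, fun k hk => Nat.find_min' hex hk,
    fun hw => h' ⟨_, (Nat.find_min' hex p).trans hi, hw⟩⟩

theorem numEdges_eq_sum [Fintype V] (G : Digraph V) :
    G.numEdges = ∑ v, Nat.card {a // G.Adj a v} := by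
  classical
  rw [← Nat.card_sigma, numEdges, ← Nat.card_coe_set_eq]
  exact Nat.card_congr
    { toFun := fun e => ⟨e.1.2, e.1.1, e.2⟩
      invFun := fun x => ⟨(x.2.1, x.1), x.2.2⟩
      left_inv := fun _ => rfl
      right_inv := fun _ => rfl }

/-- Among three pairs, two visit `v` and `w` in the same order, so a triple of pairs has distinct
critical edges into at most one vertex. -/
theorem sum_descFactorial_le [Fintype V] (P : Finset (V × V))
    (hcrit : ∀ b w, G.Adj b w → ∃ q ∈ P, ∃ j, G.IsCritical j b w q.1 q.2) :
    ∑ v, (Nat.card {a // G.Adj a v}).descFactorial 3 ≤ P.card ^ 3 := by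
  classical
  choose f hfP j hj using hcrit
  -- The domain has as many elements as the left-hand sum: a vertex with an ordered triple of
  -- distinct in-neighbours.
  let T : ((v : V) × (Fin 3 ↪ {a // G.Adj a v})) → (Fin 3 → P) :=
    fun x i => ⟨f (x.2 i).1 x.1 (x.2 i).2, hfP _ _ _⟩
  have hT : Function.Injective T := by
    rintro ⟨v, x⟩ ⟨w, y⟩ hxy
    have hf : ∀ i, f (x i).1 v (x i).2 = f (y i).1 w (y i).2 :=
      fun i => congrArg Subtype.val (congrFun hxy i)
    have hx := fun i => hj (x i).1 v (x i).2
    have hy : ∀ i, G.IsCritical (j (y i).1 w (y i).2) (y i).1 w (f (x i).1 v (x i).2).1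
        (f (x i).1 v (x i).2).2 := fun i => by
      rw [hf i]
      exact hj (y i).1 w (y i).2
    by_cases hvw : v = w
    · subst hvw
      have : x = y := by
        ext i
        exact (hx i).eq_of_head_eq (hy i)
      rw [this]
    · exfalso
      have hlen := fun i => (hx i).length_eq (hy i)
      have inj : ∀ i i', i ≠ i' → ¬ ((x i).1 = (x i').1) := fun i i' hne h =>
        hne (x.injective (Subtype.ext h))
      have inj' : ∀ i i', i ≠ i' → ¬ ((y i).1 = (y i').1) := fun i i' hne h =>
        hne (y.injective (Subtype.ext h))
      -- Pigeonhole: there are two possible orders of `v` and `w` and three pairs, so two pairs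
      -- agree. A common order identifies two entries of `y` or two of `x`, against injectivity.
      have same : ∀ i i', i ≠ i' →
          ¬ (G.Precedes (j (x i).1 v (x i).2) (f (x i).1 v (x i).2).1
              (f (x i).1 v (x i).2).2 v w ∧
            G.Precedes (j (x i').1 v (x i').2) (f (x i').1 v (x i').2).1
              (f (x i').1 v (x i').2).2 v w) := fun i i' hne hpp => by
        rw [hlen i, hlen i'] at hpp
        exact inj' i i' hne ((hy i).eq_of_precedes hvw (hy i') hpp.1 hpp.2)
      have same' : ∀ i i', i ≠ i' →
          ¬ (G.Precedes (j (x i).1 v (x i).2) (f (x i).1 v (x i).2).1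
              (f (x i).1 v (x i).2).2 w v ∧
            G.Precedes (j (x i').1 v (x i').2) (f (x i').1 v (x i').2).1
              (f (x i').1 v (x i').2).2 w v) := fun i i' hne hpp =>
        inj i i' hne ((hx i).eq_of_precedes (Ne.symm hvw) (hx i') hpp.1 hpp.2)
      have o := fun i => (hx i).precedes_or (hy i)
      have a01 := same 0 1 (by decide)
      have a02 := same 0 2 (by decide)
      have a12 := same 1 2 (by decide)
      have b01 := same' 0 1 (by decide)
      have b02 := same' 0 2 (by decide)
      have b12 := same' 1 2 (by decide)
      have o0 := o 0
      have o1 := o 1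
      have o2 := o 2
      tauto
  have := Fintype.card_le_of_injective T hT
  simpa [Fintype.card_sigma, Fintype.card_embedding_eq, Nat.card_eq_fintype_card] using this

/-- Either d ≤ L + 2, or both d - 1 and d - 2 are at least L. -/
theorem _root_.Nat.mul_sq_le_add_descFactorial_three (d L : ℕ) :
    d * L ^ 2 ≤ (2 + L) * L ^ 2 + d.descFactorial 3 := by
  rcases le_total d (2 + L) with h | h
  · exact (Nat.mul_le_mul_right _ h).trans (Nat.le_add_right _ _)
  · obtain ⟨e, rfl⟩ := Nat.exists_eq_add_of_le h
    have : (2 + L + e).descFactorial 3 = (L + e) * ((L + e + 1) * (2 + L + e)) := by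
      simp only [Nat.descFactorial]
      rw [show 2 + L + e - 2 = L + e by omega, show 2 + L + e - 1 = L + e + 1 by omega]
      simp
    rw [this]
    nlinarith [Nat.zero_le (L * e), Nat.zero_le (e * e), Nat.zero_le (L * L * e),
      Nat.zero_le (L * e * e), Nat.zero_le (e * e * e)]

/-- A sparse subgraph in which each of the pairs in `P` is joined within the same bound as in
`G`. -/
theorem exists_preserver [Fintype V] (G : Digraph V) (D L : ℕ) (P : Finset (V × V))
    (hP : ∀ q ∈ P, G.Within D q.1 q.2) :
    ∃ H ≤ G, (∀ q ∈ P, H.Within D q.1 q.2) ∧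
      H.numEdges * L ^ 2 ≤ Fintype.card V * ((2 + L) * L ^ 2) + P.card ^ 3 := by
  classical
  -- Minimality in the number of edges makes each remaining edge indispensable to some pair.
  obtain ⟨H, ⟨hHG, hH⟩, hmin⟩ := (measure (numEdges (V := V))).wf.has_min
    {H | H ≤ G ∧ ∀ q ∈ P, H.Within D q.1 q.2} ⟨G, le_rfl, hP⟩
  refine ⟨H, hHG, hH, ?_⟩
  have hcrit : ∀ b w, H.Adj b w → ∃ q ∈ P, ∃ j, H.IsCritical j b w q.1 q.2 := by
    intro b w hbw
    have hnot := fun h => hmin (H.deleteEdge b w) h (numEdges_deleteEdge_lt hbw)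
    have : ∃ q ∈ P, ¬ (H.deleteEdge b w).Within D q.1 q.2 := by
      by_contra! hcon
      exact hnot ⟨(H.deleteEdge_le b w).trans hHG, hcon⟩
    obtain ⟨q, hq, hw⟩ := this
    exact ⟨q, hq, exists_isCritical (hH q hq) hw⟩
  calc H.numEdges * L ^ 2 = ∑ v, Nat.card {a // H.Adj a v} * L ^ 2 := by
        rw [numEdges_eq_sum, Finset.sum_mul]
    _ ≤ ∑ v, ((2 + L) * L ^ 2 + (Nat.card {a // H.Adj a v}).descFactorial 3) :=
        Finset.sum_le_sum fun v _ => Nat.mul_sq_le_add_descFactorial_three _ _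
    _ = Fintype.card V * ((2 + L) * L ^ 2) +
          ∑ v, (Nat.card {a // H.Adj a v}).descFactorial 3 := by
        rw [Finset.sum_add_distrib]; simp
    _ ≤ _ := Nat.add_le_add_left (sum_descFactorial_le P hcrit) _

end Digraph

/-! ### Computability: checking certificates and exhaustive search -/

/-- Unbounded search for a witness of a primitive recursive relation is computable if a witness
always exists. -/
theorem PrimrecRel.computable_find {α : Type*} [Primcodable α] {p : α → ℕ → Prop}
    [∀ a, DecidablePred (p a)] (hp : PrimrecRel p) (h : ∀ a, ∃ m, p a m) :
    Computable fun a => Nat.find (h a) := by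
  have hp' : Primrec₂ fun a m => decide (p a m) := PrimrecRel.decide hp
  have := Partrec.rfind (p := fun a m => Part.some (decide (p a m))) hp'.to_comp.partrec₂
  refine this.of_eq_tot fun a => ?_
  refine Nat.mem_rfind.2 ⟨?_, fun {m} hm => ?_⟩
  · simpa using Nat.find_spec (h a)
  · simpa using Nat.find_min (h a) hm

theorem PrimrecPred.forall_lt' {α : Type*} [Primcodable α] {R : ℕ → α → Prop} {f : α → ℕ}
    (hR : PrimrecRel R) (hf : Primrec f) : PrimrecPred fun a => ∀ x < f a, R x a :=
  (hR.forall_mem_list.comp (Primrec.list_range.comp hf) Primrec.id).of_eq (by simp)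

theorem PrimrecRel.list_mem {α : Type*} [Primcodable α] :
    PrimrecRel fun (a : α) (L : List α) => a ∈ L :=
  ((PrimrecRel.exists_mem_list (Primrec.eq (α := α))).comp Primrec.snd Primrec.fst).of_eq (by simp)

theorem Primrec.nat_pow : Primrec₂ ((· ^ ·) : ℕ → ℕ → ℕ) :=
  Primrec₂.unpaired'.1 Nat.Primrec.pow

namespace Digraph

/-- Add to `S` the vertices below `a.1` that an edge of the list `a.2` joins to `S`. -/
def expand (a : ℕ × List (ℕ × ℕ)) (S : List ℕ) : List ℕ :=
  S ++ ((a.2.filter fun e => e.1 ∈ S ∧ e.2 < a.1).map Prod.snd)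

/-- The vertices of the digraph on `{0, …, a.1 - 1}` with edge list `a.2` within distance `k`
of `u`. -/
def reach (a : ℕ × List (ℕ × ℕ)) (k u : ℕ) : List ℕ :=
  (expand a)^[k] [u]

/-- Any two vertices are within distance `k`, in terms of edge lists. -/
def AllWithin (a : ℕ × List (ℕ × ℕ)) (k : ℕ) : Prop :=
  ∀ u < a.1, ∀ v < a.1, v ∈ reach a k u

theorem mem_reach_iff {n : ℕ} {L : List (ℕ × ℕ)} {k : ℕ} (u : Fin n) {x : ℕ} :
    x ∈ reach (n, L) k u ↔ ∃ h : x < n, (ofEdgeList n L).Within k u ⟨x, h⟩ := by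
  induction k generalizing x with
  | zero =>
    simp only [reach, Function.iterate_zero, id, List.mem_singleton, within_zero]
    exact ⟨fun h => ⟨h ▸ u.2, Fin.ext h.symm⟩, fun ⟨_, h⟩ => (congrArg Fin.val h).symm⟩
  | succ k ih =>
    have : reach (n, L) (k + 1) u = expand (n, L) (reach (n, L) k u) :=
      Function.iterate_succ_apply' _ _ _
    rw [this]
    simp only [expand, List.mem_append, ih, List.mem_map, List.mem_filter, decide_eq_true_eq,
      within_succ]
    constructor
    · rintro (⟨h, hw⟩ | ⟨⟨y, z⟩, ⟨hL, ⟨hy, hw⟩, hz⟩, rfl⟩)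
      · exact ⟨h, Or.inl hw⟩
      · exact ⟨hz, Or.inr ⟨⟨y, hy⟩, hw, hL⟩⟩
    · rintro ⟨h, hw | ⟨y, hw, hy⟩⟩
      · exact Or.inl ⟨h, hw⟩
      · exact Or.inr ⟨(y, x), ⟨hy, ⟨y.2, hw⟩, h⟩, rfl⟩

theorem allWithin_iff {n : ℕ} {L : List (ℕ × ℕ)} {k : ℕ} :
    AllWithin (n, L) k ↔ ∀ u v, (ofEdgeList n L).Within k u v :=
  ⟨fun h u v => ((mem_reach_iff u).1 (h u u.2 v v.2)).2,
    fun h u hu _ hv => (mem_reach_iff ⟨u, hu⟩).2 ⟨hv, h _ _⟩⟩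

theorem primrec_expand : Primrec₂ expand := by
  have hR : PrimrecRel fun (e : ℕ × ℕ) (b : List ℕ × ℕ) => e.1 ∈ b.1 ∧ e.2 < b.2 :=
    PrimrecPred.and
      (PrimrecRel.list_mem.comp (Primrec.fst.comp Primrec.fst) (Primrec.fst.comp Primrec.snd))
      (Primrec.nat_lt.comp (Primrec.snd.comp Primrec.fst) (Primrec.snd.comp Primrec.snd))
  have hfilter := hR.listFilter.comp (Primrec.snd.comp Primrec.fst)
    (Primrec.pair Primrec.snd (Primrec.fst.comp Primrec.fst) :
      Primrec fun x : (ℕ × List (ℕ × ℕ)) × List ℕ => (x.2, x.1.1))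
  exact Primrec.list_append.comp Primrec.snd
    (Primrec.list_map hfilter (Primrec.snd.comp Primrec.snd).to₂)

theorem primrec_reach :
    Primrec fun x : (ℕ × List (ℕ × ℕ)) × ℕ × ℕ => reach x.1 x.2.1 x.2.2 :=
  Primrec.nat_iterate (Primrec.fst.comp Primrec.snd)
    (Primrec.list_cons.comp (Primrec.snd.comp Primrec.snd) (Primrec.const []))
    (primrec_expand.comp (Primrec.fst.comp Primrec.fst) Primrec.snd).to₂

theorem primrec_allWithin : PrimrecRel AllWithin := by
  have hin : PrimrecRel fun (v : ℕ) (x : ℕ × (ℕ × List (ℕ × ℕ)) × ℕ) =>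
      v ∈ reach x.2.1 x.2.2 x.1 :=
    PrimrecRel.list_mem.comp Primrec.fst (primrec_reach.comp
      (Primrec.pair (Primrec.fst.comp (Primrec.snd.comp Primrec.snd))
        (Primrec.pair (Primrec.snd.comp (Primrec.snd.comp Primrec.snd))
          (Primrec.fst.comp Primrec.snd))))
  have hv := PrimrecPred.forall_lt' hin (Primrec.fst.comp (Primrec.fst.comp Primrec.snd))
  exact PrimrecPred.forall_lt' hv.primrecRel (Primrec.fst.comp Primrec.fst)

/-- The candidate edge list `c.1` describes a subgraph with the required properties; `c.2` holds a
lower bound for `log₂ n` and a bound for the increase of the diameter. -/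
def IsSpanner (K : ℕ) (a : ℕ × List (ℕ × ℕ)) (c : List (ℕ × ℕ) × ℕ × ℕ) : Prop :=
  (∀ e ∈ c.1, e ∈ a.2 ∧ e.1 < a.1 ∧ e.2 < a.1) ∧ (2 ^ c.2.1 ≤ a.1 ∨ c.2.1 = 0) ∧
    c.1.length ≤ K * (a.1 * c.2.1 ^ 2) ∧ c.2.2 ^ 6 ≤ a.1 ^ 5 ∧
    ∀ D < a.1, ¬ AllWithin a D ∨ AllWithin (a.1, c.1) (D + c.2.2)

theorem primrec_isSpanner (K : ℕ) : PrimrecRel (IsSpanner K) := by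
  have hn : Primrec fun x : (ℕ × List (ℕ × ℕ)) × List (ℕ × ℕ) × ℕ × ℕ => x.1.1 :=
    Primrec.fst.comp Primrec.fst
  have hM : Primrec fun x : (ℕ × List (ℕ × ℕ)) × List (ℕ × ℕ) × ℕ × ℕ => x.2.1 :=
    Primrec.fst.comp Primrec.snd
  have hk : Primrec fun x : (ℕ × List (ℕ × ℕ)) × List (ℕ × ℕ) × ℕ × ℕ => x.2.2.1 :=
    Primrec.fst.comp (Primrec.snd.comp Primrec.snd)
  have hr : Primrec fun x : (ℕ × List (ℕ × ℕ)) × List (ℕ × ℕ) × ℕ × ℕ => x.2.2.2 :=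
    Primrec.snd.comp (Primrec.snd.comp Primrec.snd)
  have hedge : PrimrecRel fun (e : ℕ × ℕ) (a : ℕ × List (ℕ × ℕ)) =>
      e ∈ a.2 ∧ e.1 < a.1 ∧ e.2 < a.1 :=
    PrimrecPred.and (PrimrecRel.list_mem.comp Primrec.fst (Primrec.snd.comp Primrec.snd))
      (PrimrecPred.and
        (Primrec.nat_lt.comp (Primrec.fst.comp Primrec.fst) (Primrec.fst.comp Primrec.snd))
        (Primrec.nat_lt.comp (Primrec.snd.comp Primrec.fst) (Primrec.fst.comp Primrec.snd)))
  have hdiam : PrimrecRel fun (D : ℕ) (x : (ℕ × List (ℕ × ℕ)) × List (ℕ × ℕ) × ℕ × ℕ) =>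
      ¬ AllWithin x.1 D ∨ AllWithin (x.1.1, x.2.1) (D + x.2.2.2) :=
    PrimrecPred.or
      (PrimrecPred.not (primrec_allWithin.comp (Primrec.fst.comp Primrec.snd) Primrec.fst))
      (primrec_allWithin.comp (Primrec.pair (hn.comp Primrec.snd) (hM.comp Primrec.snd))
        (Primrec.nat_add.comp Primrec.fst (hr.comp Primrec.snd)))
  refine PrimrecPred.and (hedge.forall_mem_list.comp hM Primrec.fst) (PrimrecPred.and
    (PrimrecPred.or (Primrec.nat_le.comp (Primrec.nat_pow.comp (Primrec.const 2) hk) hn)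
      (Primrec.eq.comp hk (Primrec.const 0))) (PrimrecPred.and
    (Primrec.nat_le.comp (Primrec.list_length.comp hM) (Primrec.nat_mul.comp (Primrec.const K)
      (Primrec.nat_mul.comp hn (Primrec.nat_pow.comp hk (Primrec.const 2))))) (PrimrecPred.and
    (Primrec.nat_le.comp (Primrec.nat_pow.comp hr (Primrec.const 6))
      (Primrec.nat_pow.comp hn (Primrec.const 5))) (PrimrecPred.forall_lt' hdiam hn))))

/-- Acceptance sees only the digraph, which makes the search independent of its presentation. -/
theorem isSpanner_congr {K n : ℕ} {L L' : List (ℕ × ℕ)} (h : ofEdgeList n L = ofEdgeList n L')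
    (c : List (ℕ × ℕ) × ℕ × ℕ) : IsSpanner K (n, L) c ↔ IsSpanner K (n, L') c := by
  have hmem : ∀ e : ℕ × ℕ, (e ∈ L ∧ e.1 < n ∧ e.2 < n) ↔ (e ∈ L' ∧ e.1 < n ∧ e.2 < n) := by
    rintro ⟨x, y⟩
    refine and_congr_left fun hxy => ?_
    exact iff_of_eq (congrArg (fun G : Digraph (Fin n) => G.Adj ⟨x, hxy.1⟩ ⟨y, hxy.2⟩) h)
  simp only [IsSpanner, hmem, allWithin_iff, h]

theorem exists_list_length_eq {n : ℕ} (G : Digraph (Fin n)) :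
    ∃ L : List (ℕ × ℕ), ofEdgeList n L = G ∧ L.length = G.numEdges ∧
      ∀ e ∈ L, e.1 < n ∧ e.2 < n := by
  classical
  refine ⟨({e : Fin n × Fin n | G.Adj e.1 e.2}.toFinset.toList).map
    fun e => ((e.1 : ℕ), (e.2 : ℕ)), ?_, ?_, ?_⟩
  · ext u v
    simp only [ofEdgeList, List.mem_map, Finset.mem_toList, Set.mem_toFinset, Set.mem_ofPred_eq,
      Prod.mk.injEq]
    constructor
    · rintro ⟨⟨a, b⟩, h, ha, hb⟩
      rw [← Fin.ext ha, ← Fin.ext hb]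
      exact h
    · intro h
      exact ⟨(u, v), h, rfl, rfl⟩
  · rw [List.length_map, Finset.length_toList, numEdges, Set.ncard_eq_toFinset_card']
  · intro e he
    obtain ⟨⟨a, b⟩, -, rfl⟩ := List.mem_map.1 he
    exact ⟨a.2, b.2⟩

theorem numEdges_ofEdgeList_le (n : ℕ) (L : List (ℕ × ℕ)) :
    (ofEdgeList n L).numEdges ≤ L.length := by
  classical
  have hinj : Function.Injective fun e : Fin n × Fin n => ((e.1 : ℕ), (e.2 : ℕ)) := by
    rintro ⟨a, b⟩ ⟨c, d⟩ h
    simp only [Prod.mk.injEq] at h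
    exact Prod.ext (Fin.ext h.1) (Fin.ext h.2)
  rw [numEdges, ← Set.ncard_image_of_injective _ hinj]
  calc _ ≤ (L.toFinset : Set (ℕ × ℕ)).ncard := by
        refine Set.ncard_le_ncard ?_ (Set.toFinite _)
        rintro _ ⟨e, he, rfl⟩
        exact List.mem_toFinset.2 he
    _ ≤ L.length := by
        rw [Set.ncard_coe_finset]
        exact L.toFinset_card_le

/-- If every strongly connected digraph has a spanner, one is found by exhaustive search. -/
theorem exists_isComputable_spanner (K : ℕ)
    (hex : ∀ (n : ℕ) (G : Digraph (Fin n)), G.StronglyConnected →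
      ∃ H ≤ G, ∃ k ρ : ℕ, (2 ^ k ≤ n ∨ k = 0) ∧ H.numEdges ≤ K * (n * k ^ 2) ∧ ρ ^ 6 ≤ n ^ 5 ∧
        ∀ u v, H.Within (G.diam + ρ) u v) :
    ∃ A : (n : ℕ) → Digraph (Fin n) → Digraph (Fin n), IsComputable A ∧
      ∀ (n : ℕ) (G : Digraph (Fin n)), G.StronglyConnected → A n G ≤ G ∧
        ∃ k ρ : ℕ, (2 ^ k ≤ n ∨ k = 0) ∧ (A n G).numEdges ≤ K * (n * k ^ 2) ∧ ρ ^ 6 ≤ n ^ 5 ∧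
          ∀ u v, (A n G).Within (G.diam + ρ) u v := by
  classical
  have htotal : ∀ a, ∃ m, IsSpanner K a (Denumerable.ofNat _ m) := by
    rintro ⟨n, L⟩
    suffices ∃ c, IsSpanner K (n, L) c by
      obtain ⟨c, hc⟩ := this
      exact ⟨Encodable.encode c, by rwa [Denumerable.ofNat_encode]⟩
    by_cases hG : (ofEdgeList n L).StronglyConnected
    · obtain ⟨H, hHG, k, ρ, hk, hE, hρ, hW⟩ := hex n _ hG
      obtain ⟨M, rfl, hM, hMn⟩ := exists_list_length_eq H
      refine ⟨(M, k, ρ), fun e he => ⟨?_, hMn e he⟩, hk, hM.trans_le hE, hρ, fun D _ => ?_⟩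
      · exact hHG (v := ⟨e.1, (hMn e he).1⟩) (w := ⟨e.2, (hMn e he).2⟩) he
      · refine or_iff_not_imp_left.2 fun hD => ?_
        rw [not_not, allWithin_iff] at hD
        exact allWithin_iff.2 fun u v =>
          (hW u v).mono le_rfl (Nat.add_le_add_right (diam_le_of_within hD) ρ)
    -- Without strong connectivity the diameter condition is vacuous and the empty list is accepted,
    -- so the search halts on every input.
    · refine ⟨([], 0, 0), by simp, Or.inr rfl, by simp, by simp, fun D _ => Or.inl fun h => ?_⟩
      exact hG (stronglyConnected_of_within (allWithin_iff.1 h))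
  let search : ℕ × List (ℕ × ℕ) → List (ℕ × ℕ) := fun a =>
    (Denumerable.ofNat (List (ℕ × ℕ) × ℕ × ℕ) (Nat.find (htotal a))).1
  have hsearch : ∀ a, ∃ c : List (ℕ × ℕ) × ℕ × ℕ, c.1 = search a ∧ IsSpanner K a c := fun a =>
    ⟨_, rfl, Nat.find_spec (htotal a)⟩
  have hcongr : ∀ (n : ℕ) (L L' : List (ℕ × ℕ)), ofEdgeList n L = ofEdgeList n L' →
      search (n, L) = search (n, L') := by
    intro n L L' h
    have : Nat.find (htotal (n, L)) = Nat.find (htotal (n, L')) :=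
      Nat.find_congr' fun {m} => isSpanner_congr h _
    simp only [search, this]
  have hcomp : Computable search := by
    have h1 : PrimrecRel fun (a : ℕ × List (ℕ × ℕ)) (m : ℕ) =>
        IsSpanner K a (Denumerable.ofNat _ m) :=
      (primrec_isSpanner K).comp Primrec.fst ((Primrec.ofNat _).comp Primrec.snd)
    exact (Primrec.fst.comp (Primrec.ofNat _)).to_comp.comp (h1.computable_find htotal)
  -- An arbitrary, noncomputable choice of edge list is harmless: by `hcongr` it does not affect the
  -- output.
  choose rep hrep using fun (n : ℕ) (G : Digraph (Fin n)) => exists_ofEdgeList_eq G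
  refine ⟨fun n G => ofEdgeList n (search (n, rep n G)), ⟨search, hcomp, fun n L => ?_⟩, ?_⟩
  · rw [hcongr n L (rep n (ofEdgeList n L)) (hrep n _).symm]
  · intro n G hG
    obtain ⟨⟨M, k, ρ⟩, hM, hsub, hk, hlen, hρ, hD⟩ := hsearch (n, rep n G)
    simp only at hM hsub hk hlen hρ hD
    simp only [← hM]
    refine ⟨?_, k, ρ, hk, (numEdges_ofEdgeList_le n M).trans hlen, hρ, fun u v => ?_⟩
    · intro u v huv
      rw [← hrep n G]
      exact (hsub _ huv).1
    · have hlt : G.diam < n :=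
        lt_of_le_of_lt (diam_le_of_within hG.within_pred) (Nat.sub_lt u.pos one_pos)
      refine allWithin_iff.1 ((hD _ hlt).resolve_left fun h => h (allWithin_iff.2 ?_)) u v
      rw [hrep n G]
      exact hG.within_diam

/-! ### Choice of parameters and assembly of the spanner -/

/-- Parameters for the hitting set: the radius `r` is about `n ^ (5 / 6) / 2`, and `k` is of order
`n ^ (1 / 6) * log n`. -/
theorem exists_radius_and_size {n : ℕ} (hn : 2 ≤ n) :
    ∃ r k : ℕ, r < n ∧ (2 * r) ^ 6 ≤ n ^ 5 ∧ k ^ 6 ≤ 2 ^ 18 * (n * Nat.log 2 n ^ 6) ∧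
      2 * n * (n - (r + 1)) ^ k < n ^ k := by
  classical
  set l := Nat.log 2 n with hl
  have hl1 : 1 ≤ l := Nat.log_pos one_lt_two hn
  have hlt : n < 2 ^ (l + 1) := Nat.lt_pow_succ_log_self one_lt_two n
  have hex : ∃ r : ℕ, n ^ 5 < (2 * (r + 1)) ^ 6 := ⟨n, by
    calc n ^ 5 ≤ n ^ 6 := Nat.pow_le_pow_right (by omega) (by omega)
      _ < (2 * (n + 1)) ^ 6 := Nat.pow_lt_pow_left (by omega) (by omega)⟩
  obtain ⟨r, hr, hr'⟩ : ∃ r : ℕ, n ^ 5 < (2 * (r + 1)) ^ 6 ∧ (2 * r) ^ 6 ≤ n ^ 5 := by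
    refine ⟨Nat.find hex, Nat.find_spec hex, ?_⟩
    rcases Nat.eq_zero_or_pos (Nat.find hex) with h | h
    · rw [h]; positivity
    · have := Nat.find_min hex (Nat.sub_lt h one_pos)
      rw [Nat.sub_add_cancel (show 1 ≤ Nat.find hex from h)] at this
      omega
  have hrn : r < n := by
    by_contra! hcon
    have : n ^ 5 < (2 * r) ^ 6 := by
      calc n ^ 5 ≤ n ^ 6 := Nat.pow_le_pow_right (by omega) (by omega)
        _ < (2 * r) ^ 6 := Nat.pow_lt_pow_left (by omega) (by omega)
    omega
  -- The lower bound makes the miss probability of a ball at most exp(-3l), which beats the 2n balls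
  -- since 2n < 2^(l+2) ≤ 2^(3l). Rounding up costs at most r + 1 ≤ l * n, hence the 4; then 2^6 *
  -- 4^6 = 2^18.
  obtain ⟨k, hk1, hk2⟩ : ∃ k : ℕ, 3 * l * n ≤ k * (r + 1) ∧ k * (r + 1) ≤ 4 * l * n := by
    have h1 := Nat.div_mul_le_self (3 * l * n) (r + 1)
    have h2 := Nat.lt_div_mul_add (a := 3 * l * n) (b := r + 1) r.succ_pos
    refine ⟨3 * l * n / (r + 1) + 1, ?_, ?_⟩ <;> rw [add_mul, one_mul]
    · omega
    · nlinarith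
  refine ⟨r, k, hrn, hr', ?_, ?_⟩
  · have h1 : (k * (r + 1)) ^ 6 ≤ (4 * l * n) ^ 6 := Nat.pow_le_pow_left hk2 6
    have h2 : k ^ 6 * n ^ 5 ≤ 2 ^ 18 * (n * l ^ 6) * n ^ 5 := by
      calc k ^ 6 * n ^ 5 ≤ k ^ 6 * (2 * (r + 1)) ^ 6 := Nat.mul_le_mul_left _ hr.le
        _ = 2 ^ 6 * (k * (r + 1)) ^ 6 := by ring
        _ ≤ 2 ^ 6 * (4 * l * n) ^ 6 := Nat.mul_le_mul_left _ h1
        _ = _ := by ring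
    exact Nat.le_of_mul_le_mul_right h2 (by positivity)
  · have hn0 : (0 : ℝ) < n := by exact_mod_cast (by omega : 0 < n)
    have hsub : ((n - (r + 1) : ℕ) : ℝ) = n * (1 - (r + 1) / n) := by
      rw [Nat.cast_sub hrn]
      field_simp
      push_cast
      ring
    have hpos : (0 : ℝ) ≤ 1 - (r + 1) / n := by
      rw [sub_nonneg, div_le_one hn0]
      exact_mod_cast hrn
    have hpow : (1 - ((r : ℝ) + 1) / n) ^ k ≤ Real.exp (-(3 * l)) := by
      calc (1 - ((r : ℝ) + 1) / n) ^ k ≤ Real.exp (-((r + 1) / n)) ^ k :=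
            pow_le_pow_left₀ hpos (Real.one_sub_le_exp_neg _) k
        _ = Real.exp (-(k * (r + 1) / n)) := by
            rw [← Real.exp_nat_mul]; congr 1; ring
        _ ≤ Real.exp (-(3 * l)) := by
            refine Real.exp_le_exp.2 (neg_le_neg ?_)
            rw [le_div_iff₀ hn0]
            exact_mod_cast hk1
    have hexp : (2 * n : ℝ) < Real.exp (3 * l) := by
      have h2 : 2 * n < 2 ^ (3 * l) := by
        calc 2 * n < 2 * 2 ^ (l + 1) := by omega
          _ = 2 ^ (l + 2) := by ring
          _ ≤ 2 ^ (3 * l) := Nat.pow_le_pow_right two_pos (by omega)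
      calc (2 * n : ℝ) < 2 ^ (3 * l) := by exact_mod_cast h2
        _ ≤ Real.exp 1 ^ (3 * l) :=
            pow_le_pow_left₀ zero_le_two (by have := Real.exp_one_gt_d9; linarith) _
        _ = Real.exp (3 * l) := by rw [← Real.exp_nat_mul]; congr 1; push_cast; ring
    have : (2 * n * (n - (r + 1) : ℕ) ^ k : ℝ) < n ^ k := by
      rw [hsub, mul_pow]
      calc 2 * n * (n ^ k * (1 - ((r : ℝ) + 1) / n) ^ k)
          ≤ 2 * n * (n ^ k * Real.exp (-(3 * l))) := by gcongr
        _ < Real.exp (3 * l) * (n ^ k * Real.exp (-(3 * l))) := by gcongr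
        _ = n ^ k := by
            rw [mul_left_comm, ← Real.exp_add, add_neg_cancel, Real.exp_zero, mul_one]
    exact_mod_cast this

/-- A set of at most `k` vertices within distance `r` of every vertex, in both directions. -/
theorem StronglyConnected.exists_hub_set {n k r : ℕ} {G : Digraph (Fin n)}
    (hG : G.StronglyConnected) (hr : r < n) (h : 2 * n * (n - (r + 1)) ^ k < n ^ k) :
    ∃ S : Finset (Fin n), S.card ≤ k ∧ (∀ u, ∃ s ∈ S, G.Within r u s) ∧
      ∀ u, ∃ s ∈ S, G.reverse.Within r u s := by
  classical
  have hball : ∀ {G : Digraph (Fin n)}, G.StronglyConnected → ∀ u,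
      r + 1 ≤ {v | G.Within r u v}.toFinset.card := fun hG u => by
    rw [← Set.ncard_eq_toFinset_card']
    have := hG.min_le_card_ball u r
    omega
  obtain ⟨S, hS, hit⟩ := Finset.exists_hitting_set (k := k) (R := r + 1) (ι := Fin n ⊕ Fin n)
    (Sum.elim (fun u => {v | G.Within r u v}.toFinset)
      fun u => {v | G.reverse.Within r u v}.toFinset)
    (by rintro (u | u) <;> [exact hball hG u; exact hball hG.reverse u])
    (by rwa [Fintype.card_sum, Fintype.card_fin, ← two_mul])
  refine ⟨S, hS, fun u => ?_, fun u => ?_⟩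
  · obtain ⟨s, hs, hus⟩ := hit (Sum.inl u)
    exact ⟨s, hs, by simpa using hus⟩
  · obtain ⟨s, hs, hus⟩ := hit (Sum.inr u)
    exact ⟨s, hs, by simpa using hus⟩

theorem StronglyConnected.exists_spanner {n : ℕ} {G : Digraph (Fin n)}
    (hG : G.StronglyConnected) :
    ∃ H ≤ G, ∃ k ρ : ℕ, (2 ^ k ≤ n ∨ k = 0) ∧ H.numEdges ≤ (2 ^ 18 + 5) * (n * k ^ 2) ∧
      ρ ^ 6 ≤ n ^ 5 ∧ ∀ u v, H.Within (G.diam + ρ) u v := by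
  classical
  rcases Nat.lt_or_ge n 2 with hn | hn
  -- For n < 2 the logarithm vanishes, but no edges are needed.
  · have : Subsingleton (Fin n) := Fin.subsingleton_iff_le_one.2 (by omega)
    refine ⟨⊥, bot_le, 0, 0, Or.inr rfl, ?_, by simp, fun u v => ?_⟩
    · simp [numEdges]
    · exact Subsingleton.elim u v ▸ .refl _ _ u
  obtain ⟨r, k, hrn, hr, hk, hkn⟩ := exists_radius_and_size hn
  obtain ⟨S, hS, hout, hin⟩ := hG.exists_hub_set hrn hkn
  obtain ⟨F₁, hF₁, hE₁, hW₁⟩ := exists_forest G S r hout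
  obtain ⟨F₂, hF₂, hE₂, hW₂⟩ := exists_forest G.reverse S r hin
  -- The value L = l² balances n * L against |S|^6 / L^2, which is of order n * l^6 / L^2.
  obtain ⟨P, hP, hWP, hEP⟩ := exists_preserver G G.diam (Nat.log 2 n ^ 2) (S ×ˢ S)
    fun q _ => hG.within_diam q.1 q.2
  have hl : 0 < Nat.log 2 n := Nat.log_pos one_lt_two hn
  rw [Fintype.card_fin] at hE₁ hE₂ hEP
  set l := Nat.log 2 n with hldef
  refine ⟨F₁ ⊔ F₂.reverse ⊔ P, sup_le (sup_le hF₁ fun _ _ h => hF₂ h) hP, l, 2 * r,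
    Or.inl (Nat.pow_log_le_self 2 (by omega)), ?_, hr, fun u v => ?_⟩
  · have hcard : (S ×ˢ S).card ^ 3 ≤ 2 ^ 18 * (n * l ^ 6) := by
      calc (S ×ˢ S).card ^ 3 = S.card ^ 6 := by rw [Finset.card_product]; ring
        _ ≤ k ^ 6 := Nat.pow_le_pow_left hS 6
        _ ≤ _ := hk
    -- Here 3 comes from 2 + L ≤ 3L and 2^18 from the hub count; the two forests raise the total
    -- constant to 2^18 + 5.
    have hP' : P.numEdges ≤ (2 ^ 18 + 3) * (n * l ^ 2) := by
      refine Nat.le_of_mul_le_mul_right (c := (l ^ 2) ^ 2) ?_ (by positivity)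
      calc P.numEdges * (l ^ 2) ^ 2 ≤ n * ((2 + l ^ 2) * (l ^ 2) ^ 2) + 2 ^ 18 * (n * l ^ 6) :=
            hEP.trans (Nat.add_le_add_left hcard _)
        _ ≤ n * ((2 * l ^ 2 + l ^ 2) * (l ^ 2) ^ 2) + 2 ^ 18 * (n * l ^ 6) := by
            gcongr
            exact Nat.le_mul_of_pos_right 2 (by positivity)
        _ = _ := by ring
    have h12 : n ≤ n * l ^ 2 := Nat.le_mul_of_pos_right n (by positivity)
    have h₁ := numEdges_sup_le (F₁ ⊔ F₂.reverse) P
    have h₂ := numEdges_sup_le F₁ F₂.reverse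
    rw [numEdges_reverse] at h₂
    omega
  · obtain ⟨s, hs, hus⟩ := hW₁ u
    obtain ⟨t, ht, htv⟩ := hW₂ v
    have hst := hWP (s, t) (Finset.mk_mem_product hs ht)
    have := ((hus.mono (le_sup_left.trans le_sup_left) le_rfl).trans
      (hst.mono le_sup_right le_rfl)).trans
      (htv.reverse.mono (le_sup_right.trans le_sup_left) le_rfl)
    exact this.mono le_rfl (by omega)

/-- An additive error of `n ^ (5 / 6)` is a factor `1 + o(1)` for diameters of larger order. -/
theorem exists_tendsto_of_diam_le_add {N : ℕ → ℕ} {G H : (k : ℕ) → Digraph (Fin (N k))}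
    (hG : ∀ k, (G k).StronglyConnected)
    (hle : ∀ k, ((H k).diam : ℝ) ≤ (G k).diam + (N k : ℝ) ^ (5 / 6 : ℝ))
    (ho : (fun k => (N k : ℝ) ^ (5 / 6 : ℝ)) =o[atTop] (fun k => ((G k).diam : ℝ))) :
    ∃ δ : ℕ → ℝ, Tendsto δ atTop (𝓝 0) ∧
      ∀ k, ((H k).diam : ℝ) ≤ (1 + δ k) * ((G k).diam : ℝ) := by
  refine ⟨_, ho.tendsto_div_nhds_zero, fun k => ?_⟩
  -- For diameter zero the quotient `δ k` is a default value, but all vertices coincide and both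
  -- diameters vanish.
  rcases Nat.eq_zero_or_pos (G k).diam with h0 | hpos
  · have hsub : ∀ u v : Fin (N k), u = v := fun u v => within_zero.1 (h0 ▸ (hG k).within_diam u v)
    have : (H k).diam ≤ 0 := diam_le_of_within fun u v => within_zero.2 (hsub u v)
    rw [Nat.le_zero.1 this, h0]
    simp
  · have : (0 : ℝ) < (G k).diam := by exact_mod_cast hpos
    rw [add_mul, one_mul, div_mul_cancel₀ _ this.ne']
    exact hle k

end Digraph

theorem mainTheorem5 :
    ∃ (A : (n : ℕ) → Digraph (Fin n) → Digraph (Fin n)) (C : ℝ),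
      Digraph.IsComputable A ∧
      (∀ (n : ℕ) (G : Digraph (Fin n)), G.StronglyConnected →
        A n G ≤ G ∧ (A n G).StronglyConnected ∧
        ((A n G).numEdges : ℝ) ≤ C * ((n : ℝ) * Real.log (n : ℝ) ^ 2) ∧
        ((A n G).diam : ℝ) ≤ (G.diam : ℝ) + (n : ℝ) / (n : ℝ) ^ (1 / 6 : ℝ)) ∧
      (∀ (N : ℕ → ℕ) (G : (k : ℕ) → Digraph (Fin (N k))),
        (∀ k, (G k).StronglyConnected) →
        (fun k => (N k : ℝ) ^ (5 / 6 : ℝ)) =o[atTop] (fun k => ((G k).diam : ℝ)) →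
        ∃ δ : ℕ → ℝ, Tendsto δ atTop (𝓝 0) ∧
          ∀ k, ((A (N k) (G k)).diam : ℝ) ≤ (1 + δ k) * ((G k).diam : ℝ)) := by
  obtain ⟨A, hA, hspec⟩ := Digraph.exists_isComputable_spanner (2 ^ 18 + 5)
    fun _ _ hG => hG.exists_spanner
  have hdiam : ∀ (n : ℕ) (G : Digraph (Fin n)), G.StronglyConnected →
      ((A n G).diam : ℝ) ≤ G.diam + (n : ℝ) ^ (5 / 6 : ℝ) := by
    intro n G hG
    obtain ⟨-, k, ρ, -, -, hρ, hW⟩ := hspec n G hG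
    have h1 : ((A n G).diam : ℝ) ≤ G.diam + ρ := by exact_mod_cast Digraph.diam_le_of_within hW
    have h2 : (ρ : ℝ) ≤ (n : ℝ) ^ (5 / 6 : ℝ) := by
      refine le_of_pow_le_pow_left₀ (n := 6) (by norm_num) (by positivity) ?_
      rw [← Real.rpow_mul_natCast n.cast_nonneg]
      norm_num
      exact_mod_cast hρ
    linarith
  have hsc : ∀ (n : ℕ) (G : Digraph (Fin n)), G.StronglyConnected → (A n G).StronglyConnected :=
    fun n G hG => let ⟨_, _, _, _, _, _, hW⟩ := hspec n G hG
      Digraph.stronglyConnected_of_within hW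
  -- The factor 1 / (log 2)² converts the bound in log₂ n to the natural logarithm.
  refine ⟨A, (2 ^ 18 + 5) / Real.log 2 ^ 2, hA, fun n G hG =>
    ⟨(hspec n G hG).1, hsc n G hG, ?_, ?_⟩,
    fun N G hG ho => Digraph.exists_tendsto_of_diam_le_add hG
      (fun k => hdiam _ _ (hG k)) ho⟩
  · obtain ⟨-, k, -, hk, hE, -, -⟩ := hspec n G hG
    have hlog2 : 0 < Real.log 2 := Real.log_pos one_lt_two
    have hkl : k * Real.log 2 ≤ Real.log n := by
      rcases hk with hk | rfl
      · rw [← Real.log_pow]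
        exact Real.log_le_log (by positivity) (by exact_mod_cast hk)
      · simpa using Real.log_natCast_nonneg n
    calc ((A n G).numEdges : ℝ) ≤ (2 ^ 18 + 5) * (n * k ^ 2) := by exact_mod_cast hE
      _ = (2 ^ 18 + 5) / Real.log 2 ^ 2 * (n * (k * Real.log 2) ^ 2) := by field_simp
      _ ≤ (2 ^ 18 + 5) / Real.log 2 ^ 2 * (n * Real.log n ^ 2) := by gcongr
  · refine (hdiam n G hG).trans (add_le_add_right (le_of_eq ?_) _)
    rcases Nat.eq_zero_or_pos n with rfl | hn
    · simp
    · have hn0 : (0 : ℝ) < n := by exact_mod_cast hn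
      rw [eq_div_iff (by positivity), ← Real.rpow_add hn0]
      norm_num
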